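/- **Setting.** Let $X_{\rm trn}\in\mathbb R^{N\times m}$, $Y_{\rm trn}\in\mathbb R^{N\times n}$, $X_{\rm val}\in\mathbb R^{N'\times m}$, $Y_{\rm val}\in\mathbb R^{N'\times n}$ with $m\ge\max\{N,N'\}$, let $h\ge\max\{m,n\}$, and let $X_{\rm trn},X_{\rm val}$ have full row rank. For $W_1\in\mathbb R^{m\times h}$, $W_2\in\mathbb R^{h\times n}$ put (Frobenius norm) $$L_{\rm trn}(W_1,W_2)=\tfrac12\|Y_{\rm trn}-X_{\rm trn}W_1W_2\|^2,\quad L_{\rm val}(W_1,W_2)=\tfrac12\|Y_{\rm val}-X_{\rm val}W_1W_2\|^2,\quad L_{\rm trn}^*(W_1)=\min_{W_2}L_{\rm trn}(W_1,W_2).$$ The bilevel problem is $\min_{W_1,\;W_2\in\mathcal S(W_1)}L_{\rm val}(W_1,W_2)$ with $\mathcal S(W_1)=\arg\min_{W_2}L_{\rm trn}(W_1,W_2)$. A pair $(W_1,W_2)$ is an $(\epsilon_1,\epsilon_2)$ solution of it if $L_{\rm trn}(W_1,W_2)-L^*_{\rm trn}(W_1)\le\epsilon_2$ and $L_{\rm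 val}(W_1,W_2)\le L_{\rm val}(W_1',W_2')+\epsilon_1$ for all $(W_1',W_2')$ with $L_{\rm trn}(W_1',W_2')-L^*_{\rm trn}(W_1')\le\epsilon_2$. For $\gamma>0$ let $L_\gamma=L_{\rm val}+\gamma(L_{\rm trn}-L_{\rm trn}^*)$; a pair is an $\epsilon$-solution of the penalized problem with parameter $\gamma$ if $L_\gamma(W_1,W_2)\le L_\gamma(W_1',W_2')+\epsilon$ for all $(W_1',W_2')$. **Assumption.** For all $\epsilon_1,\epsilon_2\ge0$ there is an $(\epsilon_1,\epsilon_2)$ solution $(W_1^*,W_2^*)$ of the bilevel problem with $L_{\rm trn}(W_1^*,W_2^*)-\min_{W_1,W_2}L_{\rm trn}(W_1,W_2)\le\epsilon_2$. **Theorem (Relations of global solutions).** Under this assumption: 1. For every $\kappa>0$ there is $C>0$, depending only on $\kappa$ and the problem data, such that for all $\epsilon_2>0$ and all $\gamma\ge\kappa\,\epsilon_2^{-1}$, every $\epsilon_2$-solution of the penalized problem with parameter $\gamma$ is an $(\epsilon_2,\epsilon_\gamma)$ solution of the bilevel problem for some $\epsilon_\gamma$ with $0\le\epsilon_\gamma\le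 C\epsilon_2^2$. 2. Conversely, there is $C>0$, depending only on the problem data, such that for every $\epsilon_1>0$ there is $\gamma^*$ with $0<\gamma^*\le C\epsilon_1^{-1}$ such that for every $\gamma>\gamma^*$, every global solution of the bilevel problem is an $\epsilon_1$-solution of the penalized problem with parameter $\gamma$. -/

import Mathlib

noncomputable section

namespace BilevelRep

section Abstract

variable {U V : Type*}

/-- The lower-level value function `g*(u) = min_v g(u,v)`, written as an infimum. For the
least-squares losses used below, `g` is nonnegative and `V` is nonempty, so the infimum is a
genuine one (and it is attained). -/
def valueFn (g : U → V → ℝ) (u : U) : ℝ := ⨅ v, g u v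

/-- The lower-level solution set `S(u) = argmin_v g(u,v)`. -/
def lowerSolutions (g : U → V → ℝ) (u : U) : Set V := {v | ∀ v', g u v ≤ g u v'}

/-- `(u,v)` is a global solution of `min_{u, v ∈ S(u)} f(u,v)`. -/
def IsGlobalBilevelSolution (f g : U → V → ℝ) (u : U) (v : V) : Prop :=
  v ∈ lowerSolutions g u ∧ ∀ u' v', v' ∈ lowerSolutions g u' → f u v ≤ f u' v'

/-- `(u,v)` is an `(ε₁, ε₂)` global solution of the bilevel problem: it is `ε₂`-feasible, and
its upper-level value is within `ε₁` of that of every `ε₂`-feasible point. -/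
def IsApproxBilevelSolution (f g : U → V → ℝ) (ε₁ ε₂ : ℝ) (u : U) (v : V) : Prop :=
  g u v - valueFn g u ≤ ε₂ ∧
    ∀ u' v', g u' v' - valueFn g u' ≤ ε₂ → f u v ≤ f u' v' + ε₁

/-- The penalized objective `L_γ(u,v) = f(u,v) + γ (g(u,v) - g*(u))`. -/
def penalized (f g : U → V → ℝ) (γ : ℝ) (u : U) (v : V) : ℝ :=
  f u v + γ * (g u v - valueFn g u)

/-- `(u,v)` is an `ε` global solution of the penalized problem with parameter `γ`. -/
def IsApproxPenalizedSolution (f g : U → V → ℝ) (γ ε : ℝ) (u : U) (v : V) : Prop :=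
  ∀ u' v', penalized f g γ u v ≤ penalized f g γ u' v' + ε

end Abstract

section Loss

attribute [local instance] Matrix.frobeniusNormedAddCommGroup

/-- Least-squares loss `½ ‖Y - X W₁ W₂‖²` (Frobenius norm) of a two-layer linear network. -/
def lsLoss {N m n h : ℕ} (X : Matrix (Fin N) (Fin m) ℝ) (Y : Matrix (Fin N) (Fin n) ℝ)
    (W₁ : Matrix (Fin m) (Fin h) ℝ) (W₂ : Matrix (Fin h) (Fin n) ℝ) : ℝ :=
  1 / 2 * ‖Y - X * W₁ * W₂‖ ^ 2

end Loss

/-- For all `ε₁, ε₂ ≥ 0` the bilevel representation learning problem with hidden width `h` has an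
`(ε₁, ε₂)` solution whose training loss is within `ε₂` of its minimum over both layers. -/
def SharedBackbone {N N' m n : ℕ} (h : ℕ)
    (Xtrn : Matrix (Fin N) (Fin m) ℝ) (Ytrn : Matrix (Fin N) (Fin n) ℝ)
    (Xval : Matrix (Fin N') (Fin m) ℝ) (Yval : Matrix (Fin N') (Fin n) ℝ) : Prop :=
  ∀ ε₁ ε₂ : ℝ, 0 ≤ ε₁ → 0 ≤ ε₂ →
    ∃ (W₁ : Matrix (Fin m) (Fin h) ℝ) (W₂ : Matrix (Fin h) (Fin n) ℝ),
      IsApproxBilevelSolution (lsLoss Xval Yval) (lsLoss Xtrn Ytrn) ε₁ ε₂ W₁ W₂ ∧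
      lsLoss Xtrn Ytrn W₁ W₂ -
        (⨅ W : Matrix (Fin m) (Fin h) ℝ × Matrix (Fin h) (Fin n) ℝ,
          lsLoss Xtrn Ytrn W.1 W.2) ≤ ε₂

end BilevelRep

end

namespace BilevelRep

section Abstract

variable {U V : Type*} {f g : U → V → ℝ}

/-! Write `p` for the lower-level gap and `f*` for the bilevel value. Everything rests on the growth
bound `f* - f ≤ K √p` (`SharedBackbone.exists_sqrt_growth`). Given it, an `ε`-solution of the
penalized problem satisfies `γ p ≤ K √p + ε`, so `p = O(ε²)` when `γ ≥ κ / ε`; conversely `K √p - γ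
p ≤ K² / (4γ)` bounds what infeasibility can gain.

A small gap at `W₁` does not make the training loss small, since `W₁` may be a poor backbone. The
assumption supplies a competitor that does no worse in validation and has training loss at most `p`.
Full row rank and width then let it be corrected to an interpolating, hence feasible, network at a
cost `O(√p)` in root validation loss. -/

theorem valueFn_le (hg : ∀ u v, 0 ≤ g u v) (u : U) (v : V) : valueFn g u ≤ g u v :=
  ciInf_le ⟨0, by rintro _ ⟨w, rfl⟩; exact hg u w⟩ v

theorem sub_valueFn_eq_zero (hg : ∀ u v, 0 ≤ g u v) {u : U} {v : V}
    (hv : v ∈ lowerSolutions g u) : g u v - valueFn g u = 0 := by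
  have : Nonempty V := ⟨v⟩
  have h1 : g u v ≤ valueFn g u := le_ciInf hv
  linarith [valueFn_le hg u v]

theorem mem_lowerSolutions_of_sub_valueFn_le_zero (hg : ∀ u v, 0 ≤ g u v) {u : U} {v : V}
    (h : g u v - valueFn g u ≤ 0) : v ∈ lowerSolutions g u := fun v' => by
  linarith [valueFn_le hg u v']

/-- An exact approximate solution, with both tolerances zero, is a global solution. -/
theorem IsApproxBilevelSolution.isGlobal (hg : ∀ u v, 0 ≤ g u v) {u : U} {v : V}
    (h : IsApproxBilevelSolution f g 0 0 u v) : IsGlobalBilevelSolution f g u v :=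
  ⟨mem_lowerSolutions_of_sub_valueFn_le_zero hg h.1, fun u' v' hv' => by
    simpa using h.2 u' v' (sub_valueFn_eq_zero hg hv').le⟩

/-- A penalized `ε`-solution solves the bilevel problem relaxed by its own lower-level gap. -/
theorem IsApproxPenalizedSolution.isApproxBilevelSolution {γ ε : ℝ} (hγ : 0 ≤ γ) {u : U} {v : V}
    (h : IsApproxPenalizedSolution f g γ ε u v) :
    IsApproxBilevelSolution f g ε (g u v - valueFn g u) u v := by
  refine ⟨le_rfl, fun u' v' hv' => ?_⟩
  have h1 := h u' v'
  have h2 := mul_le_mul_of_nonneg_left hv' hγ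
  unfold penalized at h1
  linarith

/-- If the optimal bilevel value exceeds `f` by at most `K` times the square root of the
lower-level gap, the gap of a penalized `ε`-solution is quadratic in `ε` once `γ ≥ κ / ε`. -/
theorem IsApproxPenalizedSolution.gap_le (hg : ∀ u v, 0 ≤ g u v) {K κ γ ε : ℝ}
    (hκ : 0 < κ) (hε : 0 < ε) (hγ : κ / ε ≤ γ) {u₀ : U} {v₀ : V}
    (h₀ : IsGlobalBilevelSolution f g u₀ v₀)
    (hK : ∀ u v, f u₀ v₀ - f u v ≤ K * √(g u v - valueFn g u)) {u : U} {v : V}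
    (h : IsApproxPenalizedSolution f g γ ε u v) :
    g u v - valueFn g u ≤ (K ^ 2 / κ ^ 2 + 2 / κ) * ε ^ 2 := by
  have h1 := h u₀ v₀
  unfold penalized at h1
  rw [sub_valueFn_eq_zero hg h₀.1] at h1
  have hp : 0 ≤ g u v - valueFn g u := sub_nonneg.2 (valueFn_le hg u v)
  have h2 := hK u v
  have hs := Real.sq_sqrt hp
  generalize √(g u v - valueFn g u) = s at *
  rw [← hs] at h1 ⊢
  have h3 : κ * s ^ 2 ≤ ε * (K * s + ε) := by
    have h4 : κ / ε * s ^ 2 ≤ K * s + ε := by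
      have := mul_le_mul_of_nonneg_right hγ (sq_nonneg s)
      linarith
    calc κ * s ^ 2 = ε * (κ / ε * s ^ 2) := by field_simp
      _ ≤ _ := mul_le_mul_of_nonneg_left h4 hε.le
  -- Young's inequality `2κKεs ≤ κ²s² + K²ε²` absorbs the cross term of `κ * h3`.
  have h5 : κ ^ 2 * s ^ 2 ≤ (K ^ 2 + 2 * κ) * ε ^ 2 := by
    nlinarith [sq_nonneg (κ * s - K * ε), mul_le_mul_of_nonneg_left h3 hκ.le]
  calc s ^ 2 = κ ^ 2 * s ^ 2 / κ ^ 2 := by field_simp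
    _ ≤ (K ^ 2 + 2 * κ) * ε ^ 2 / κ ^ 2 := by gcongr
    _ = _ := by field_simp

/-- Under the same growth condition, global bilevel solutions are penalized `ε`-solutions as soon
as `K² / 4 ≤ γ ε`. -/
theorem IsGlobalBilevelSolution.isApproxPenalizedSolution (hg : ∀ u v, 0 ≤ g u v) {K γ ε : ℝ}
    (hγ : 0 < γ) (hγε : K ^ 2 / 4 ≤ γ * ε) {u₀ : U} {v₀ : V}
    (h₀ : IsGlobalBilevelSolution f g u₀ v₀)
    (hK : ∀ u v, f u₀ v₀ - f u v ≤ K * √(g u v - valueFn g u)) :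
    IsApproxPenalizedSolution f g γ ε u₀ v₀ := by
  intro u v
  unfold penalized
  rw [sub_valueFn_eq_zero hg h₀.1]
  have h2 := hK u v
  have hs := Real.sq_sqrt (sub_nonneg.2 (valueFn_le hg u v))
  generalize √(g u v - valueFn g u) = s at *
  rw [← hs]
  have h3 : K * s ≤ γ * s ^ 2 + ε := by
    refine le_of_mul_le_mul_left ?_ hγ
    nlinarith [sq_nonneg (γ * s - K / 2)]
  linarith

theorem IsGlobalBilevelSolution.value_eq {u u' : U} {v v' : V}
    (h : IsGlobalBilevelSolution f g u v) (h' : IsGlobalBilevelSolution f g u' v') :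
    f u v = f u' v' :=
  le_antisymm (h.2 _ _ h'.1) (h'.2 _ _ h.1)

end Abstract

section Loss

attribute [local instance] Matrix.frobeniusNormedAddCommGroup

variable {N N' m n h : ℕ}

theorem lsLoss_nonneg (X : Matrix (Fin N) (Fin m) ℝ) (Y : Matrix (Fin N) (Fin n) ℝ)
    (W₁ : Matrix (Fin m) (Fin h) ℝ) (W₂ : Matrix (Fin h) (Fin n) ℝ) : 0 ≤ lsLoss X Y W₁ W₂ := by
  unfold lsLoss
  positivity

theorem norm_residual_eq (X : Matrix (Fin N) (Fin m) ℝ) (Y : Matrix (Fin N) (Fin n) ℝ)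
    (W₁ : Matrix (Fin m) (Fin h) ℝ) (W₂ : Matrix (Fin h) (Fin n) ℝ) :
    ‖Y - X * W₁ * W₂‖ = √2 * √(lsLoss X Y W₁ W₂) := by
  rw [← Real.sqrt_mul zero_le_two, lsLoss, ← mul_assoc, mul_one_div_cancel two_ne_zero, one_mul,
    Real.sqrt_sq (norm_nonneg _)]

theorem exists_right_inverse_of_rank_eq {X : Matrix (Fin N) (Fin m) ℝ} (hX : X.rank = N) :
    ∃ B : Matrix (Fin m) (Fin N) ℝ, X * B = 1 := by
  rw [← Matrix.mulVec_surjective_iff_exists_right_inverse]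
  have : LinearMap.range X.mulVecLin = ⊤ :=
    Submodule.eq_top_of_finrank_eq (by simpa [Matrix.rank] using hX)
  exact LinearMap.range_eq_top.1 this

/-- The width imposes no rank constraint: `E = [I 0]` has orthonormal rows, so `E (Eᵀ M) = M`. -/
theorem exists_mul_eq_of_le (hmh : m ≤ h) (M : Matrix (Fin m) (Fin n) ℝ) :
    ∃ (W₁ : Matrix (Fin m) (Fin h) ℝ) (W₂ : Matrix (Fin h) (Fin n) ℝ), W₁ * W₂ = M := by
  let E : Matrix (Fin m) (Fin h) ℝ := (1 : Matrix (Fin h) (Fin h) ℝ).submatrix (Fin.castLE hmh) id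
  have hE : E * E.transpose = 1 := by
    ext i j
    simp [E, Matrix.mul_apply, Matrix.one_apply, eq_comm]
  exact ⟨E, E.transpose * M, by rw [← Matrix.mul_assoc, hE, Matrix.one_mul]⟩

/-- Any two-layer network can be corrected to one that interpolates the data `(X, Y)`, with the
square root of another loss growing at most linearly in that of the interpolation error. -/
theorem exists_interpolating_sqrt_lsLoss_le (hmh : m ≤ h)
    {X : Matrix (Fin N) (Fin m) ℝ} (hX : X.rank = N) (Y : Matrix (Fin N) (Fin n) ℝ)
    (X' : Matrix (Fin N') (Fin m) ℝ) (Y' : Matrix (Fin N') (Fin n) ℝ) :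
    ∃ c : ℝ, 0 ≤ c ∧ ∀ (W₁ : Matrix (Fin m) (Fin h) ℝ) (W₂ : Matrix (Fin h) (Fin n) ℝ),
      ∃ (V₁ : Matrix (Fin m) (Fin h) ℝ) (V₂ : Matrix (Fin h) (Fin n) ℝ),
        lsLoss X Y V₁ V₂ = 0 ∧
        √(lsLoss X' Y' V₁ V₂) ≤ √(lsLoss X' Y' W₁ W₂) + c * √(lsLoss X Y W₁ W₂) := by
  obtain ⟨B, hB⟩ := exists_right_inverse_of_rank_eq hX
  refine ⟨‖X' * B‖, norm_nonneg _, fun W₁ W₂ => ?_⟩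
  -- Since `X B = 1`, adding `B` times the residual to the product cancels the residual exactly.
  obtain ⟨V₁, V₂, hV⟩ := exists_mul_eq_of_le hmh (W₁ * W₂ + B * (Y - X * W₁ * W₂))
  refine ⟨V₁, V₂, ?_, ?_⟩
  · have : Y - X * V₁ * V₂ = 0 := by
      rw [Matrix.mul_assoc, hV, Matrix.mul_add, ← Matrix.mul_assoc X B, hB, Matrix.one_mul,
        Matrix.mul_assoc]
      abel
    simp [lsLoss, this]
  · have h1 : Y' - X' * V₁ * V₂ = (Y' - X' * W₁ * W₂) - X' * B * (Y - X * W₁ * W₂) := by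
      rw [Matrix.mul_assoc X' V₁, hV, Matrix.mul_add, ← Matrix.mul_assoc X' B,
        ← Matrix.mul_assoc X' W₁]
      abel
    have h2 : ‖Y' - X' * V₁ * V₂‖ ≤
        ‖Y' - X' * W₁ * W₂‖ + ‖X' * B‖ * ‖Y - X * W₁ * W₂‖ := by
      rw [h1]
      exact (norm_sub_le _ _).trans (by gcongr; exact Matrix.frobenius_norm_mul _ _)
    simp only [norm_residual_eq] at h2
    refine le_of_mul_le_mul_left ?_ (Real.sqrt_pos.2 zero_lt_two)
    linarith

theorem iInf_lsLoss_eq_zero (hmh : m ≤ h)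
    {X : Matrix (Fin N) (Fin m) ℝ} (hX : X.rank = N) (Y : Matrix (Fin N) (Fin n) ℝ) :
    (⨅ W : Matrix (Fin m) (Fin h) ℝ × Matrix (Fin h) (Fin n) ℝ, lsLoss X Y W.1 W.2) = 0 := by
  obtain ⟨c, -, hc⟩ := exists_interpolating_sqrt_lsLoss_le (h := h) hmh hX Y X Y
  obtain ⟨V₁, V₂, hV, -⟩ := hc 0 0
  refine le_antisymm ?_ (Real.iInf_nonneg fun W => lsLoss_nonneg _ _ _ _)
  rw [← hV]
  exact ciInf_le (f := fun W : Matrix (Fin m) (Fin h) ℝ × Matrix (Fin h) (Fin n) ℝ =>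
    lsLoss X Y W.1 W.2) ⟨0, by rintro _ ⟨W, rfl⟩; exact lsLoss_nonneg _ _ _ _⟩ (V₁, V₂)

/-- The bilevel value exceeds the validation loss of any network by at most a multiple of the
square root of its lower-level gap. -/
theorem SharedBackbone.exists_sqrt_growth (hmh : m ≤ h)
    {Xtrn : Matrix (Fin N) (Fin m) ℝ} {Ytrn : Matrix (Fin N) (Fin n) ℝ}
    {Xval : Matrix (Fin N') (Fin m) ℝ} {Yval : Matrix (Fin N') (Fin n) ℝ}
    (hX : Xtrn.rank = N) (hA : SharedBackbone h Xtrn Ytrn Xval Yval)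
    {U₁ : Matrix (Fin m) (Fin h) ℝ} {U₂ : Matrix (Fin h) (Fin n) ℝ}
    (hU : IsGlobalBilevelSolution (lsLoss Xval Yval) (lsLoss Xtrn Ytrn) U₁ U₂) :
    ∃ K : ℝ, ∀ (W₁ : Matrix (Fin m) (Fin h) ℝ) (W₂ : Matrix (Fin h) (Fin n) ℝ),
      lsLoss Xval Yval U₁ U₂ - lsLoss Xval Yval W₁ W₂ ≤
        K * √(lsLoss Xtrn Ytrn W₁ W₂ - valueFn (lsLoss Xtrn Ytrn) W₁) := by
  obtain ⟨c, hc0, hc⟩ := exists_interpolating_sqrt_lsLoss_le (h := h) hmh hX Ytrn Xval Yval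
  refine ⟨2 * c * √(lsLoss Xval Yval U₁ U₂), fun W₁ W₂ => ?_⟩
  have hp : 0 ≤ lsLoss Xtrn Ytrn W₁ W₂ - valueFn (lsLoss Xtrn Ytrn) W₁ :=
    sub_nonneg.2 (valueFn_le (lsLoss_nonneg Xtrn Ytrn) W₁ W₂)
  -- The tolerance is the gap of `W` itself, so `W` is an admissible competitor.
  obtain ⟨Z₁, Z₂, hZ, hZtrn⟩ := hA 0 _ le_rfl hp
  rw [iInf_lsLoss_eq_zero hmh hX, sub_zero] at hZtrn
  have hZW := hZ.2 W₁ W₂ le_rfl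
  obtain ⟨V₁, V₂, hV, hVZ⟩ := hc Z₁ Z₂
  have hUV : lsLoss Xval Yval U₁ U₂ ≤ lsLoss Xval Yval V₁ V₂ :=
    hU.2 _ _ fun V' => by rw [hV]; exact lsLoss_nonneg _ _ _ _
  set s := √(lsLoss Xtrn Ytrn W₁ W₂ - valueFn (lsLoss Xtrn Ytrn) W₁)
  have key : √(lsLoss Xval Yval U₁ U₂) ≤ √(lsLoss Xval Yval W₁ W₂) + c * s := by
    refine (Real.sqrt_le_sqrt hUV).trans (hVZ.trans ?_)
    gcongr
    · simpa using hZW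
    · exact Real.sqrt_le_sqrt hZtrn
  have hs : 0 ≤ s := Real.sqrt_nonneg _
  have ha := Real.sqrt_nonneg (lsLoss Xval Yval U₁ U₂)
  have hb := Real.sqrt_nonneg (lsLoss Xval Yval W₁ W₂)
  have ha2 := Real.sq_sqrt (lsLoss_nonneg Xval Yval U₁ U₂)
  have hb2 := Real.sq_sqrt (lsLoss_nonneg Xval Yval W₁ W₂)
  generalize √(lsLoss Xval Yval U₁ U₂) = a at *
  generalize √(lsLoss Xval Yval W₁ W₂) = b at *
  rw [← ha2, ← hb2]
  -- `a² - b² = 2a(a - b) - (a - b)² ≤ 2a · c s`.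
  nlinarith [sq_nonneg (a - b), mul_le_mul_of_nonneg_left key ha]

end Loss

end BilevelRep

theorem mainTheorem6 {N N' m n h : ℕ}
    (Xtrn : Matrix (Fin N) (Fin m) ℝ) (Ytrn : Matrix (Fin N) (Fin n) ℝ)
    (Xval : Matrix (Fin N') (Fin m) ℝ) (Yval : Matrix (Fin N') (Fin n) ℝ)
    (hm : max N N' ≤ m) (hh : max m n ≤ h)
    (hXtrn : Xtrn.rank = N) (hXval : Xval.rank = N')
    (hA : BilevelRep.SharedBackbone h Xtrn Ytrn Xval Yval) :
    (∀ κ : ℝ, 0 < κ → ∃ C : ℝ, 0 < C ∧ ∀ ε₂ : ℝ, 0 < ε₂ → ∀ γ : ℝ, κ / ε₂ ≤ γ →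
      ∀ (W₁ : Matrix (Fin m) (Fin h) ℝ) (W₂ : Matrix (Fin h) (Fin n) ℝ),
        BilevelRep.IsApproxPenalizedSolution
          (BilevelRep.lsLoss Xval Yval) (BilevelRep.lsLoss Xtrn Ytrn) γ ε₂ W₁ W₂ →
        ∃ εγ : ℝ, 0 ≤ εγ ∧ εγ ≤ C * ε₂ ^ 2 ∧
          BilevelRep.IsApproxBilevelSolution
            (BilevelRep.lsLoss Xval Yval) (BilevelRep.lsLoss Xtrn Ytrn) ε₂ εγ W₁ W₂) ∧
    (∃ C : ℝ, 0 < C ∧ ∀ ε₁ : ℝ, 0 < ε₁ → ∃ γstar : ℝ, 0 < γstar ∧ γstar ≤ C * ε₁⁻¹ ∧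
      ∀ γ : ℝ, γstar < γ →
        ∀ (W₁ : Matrix (Fin m) (Fin h) ℝ) (W₂ : Matrix (Fin h) (Fin n) ℝ),
          BilevelRep.IsGlobalBilevelSolution
            (BilevelRep.lsLoss Xval Yval) (BilevelRep.lsLoss Xtrn Ytrn) W₁ W₂ →
          BilevelRep.IsApproxPenalizedSolution
            (BilevelRep.lsLoss Xval Yval) (BilevelRep.lsLoss Xtrn Ytrn) γ ε₁ W₁ W₂) := by
  obtain ⟨U₁, U₂, hU, -⟩ := hA 0 0 le_rfl le_rfl
  have hg := BilevelRep.lsLoss_nonneg (h := h) Xtrn Ytrn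
  replace hU := hU.isGlobal hg
  obtain ⟨K, hK⟩ := hA.exists_sqrt_growth ((le_max_left m n).trans hh) hXtrn hU
  -- The `+ 1` keeps `C` and `γstar` positive even if `K = 0`.
  refine ⟨fun κ hκ => ⟨K ^ 2 / κ ^ 2 + 2 / κ, by positivity, fun ε₂ hε₂ γ hγ W₁ W₂ hW => ?_⟩,
    K ^ 2 / 4 + 1, by positivity, fun ε₁ hε₁ => ⟨(K ^ 2 / 4 + 1) * ε₁⁻¹, by positivity, le_rfl,
      fun γ hγ W₁ W₂ hW => ?_⟩⟩
  · exact ⟨_, sub_nonneg.2 (BilevelRep.valueFn_le hg W₁ W₂), hW.gap_le hg hκ hε₂ hγ hU hK,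
      hW.isApproxBilevelSolution ((by positivity : 0 ≤ κ / ε₂).trans hγ)⟩
  · have hγ0 : 0 < γ := lt_trans (by positivity) hγ
    refine hW.isApproxPenalizedSolution hg (K := K) hγ0 ?_ fun V₁ V₂ => ?_
    · rw [← div_eq_mul_inv, div_lt_iff₀ hε₁] at hγ
      linarith
    · rw [hW.value_eq hU]
      exact hK V₁ V₂
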